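/- Let $\ell^\infty(\mathbb Z)$ be the Banach space of bounded functions $\psi:\mathbb Z\to\mathbb C$ with the supremum norm. A *mean* is a continuous linear functional $\varphi$ on $\ell^\infty(\mathbb Z)$ such that $\varphi(\psi)\ge 0$ whenever $\psi\ge 0$, and $\varphi(\mathbf 1)=1$. Let $\mathcal T_+$ be the set of means $\varphi$ such that $\varphi(g*\psi)=\varphi(\psi)$ for all $\psi\in\ell^\infty(\mathbb Z)$ and all $g\in\ell^1(\mathbb Z)$ with $g\ge 0$ and $\sum_t g(t)=1$, where $(g*\psi)(x)=\sum_{t\in\mathbb Z}g(t)\psi(x-t)$, and such that $\varphi(\psi)=0$ for every $\psi\in\ell^\infty(\mathbb Z)$ with $\lim_{x\to+\infty}\psi(x)=0$. A complex sequence $(s_n)_{n\ge 0}$ is *one-sidedly almost convergent* to $\alpha\in\mathbb C$ if it is bounded and its extension $\tilde s$ to $\mathbb Z$ by $0$ on the negative integers satisfies $\varphi(\tilde s)=\alpha$ for every $\varphi\in\mathcal T_+$. **Theorem 8.3.** Let $(a_n)_{n\ge 0}$ be a sequence of complex numbers that is bounded from below, i.e. there is a constant $C>0$ such that $\operatorname{Re}a_n\ge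 -C$ and $\operatorname{Im}a_n\ge -C$ for every $n\ge 0$. Suppose that the series $f(z)=\sum_{n=0}^\infty a_nz^n$ converges for every $|z|<1$, and that $f$ is analytic at $z=1$, i.e. it extends analytically from the open unit disc to a neighbourhood of $1$; write $f(1)$ for the value of the extension at $1$. Then the sequence of partial sums $s_n=\sum_{k=0}^n a_k$ is bounded and one-sidedly almost convergent to $f(1)$. -/

import Mathlib

open scoped ENNReal ComplexOrder Topology

namespace AlmostConv

/-- `L^∞(ℤ) = ℓ^∞(ℤ)`: bounded complex functions on `ℤ`, with the supremum norm. -/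
abbrev LInfZ : Type := lp (fun _ : ℤ => ℂ) ∞

/-- `L¹(ℤ) = ℓ¹(ℤ)`: the Haar measure of `ℤ` is the counting measure. -/
abbrev L1Z : Type := lp (fun _ : ℤ => ℂ) 1

/-- `L^∞(ℤ₊) = ℓ^∞`: bounded complex sequences indexed by `n ≥ 0`. -/
abbrev LInfN : Type := lp (fun _ : ℕ => ℂ) ∞

theorem summable_norm_L1Z (f : L1Z) : Summable fun t : ℤ => ‖f t‖ := by
  have h := lp.memℓp f
  rw [memℓp_gen_iff (by norm_num)] at h
  simpa using h

theorem summable_norm_conv (f : L1Z) (ψ : LInfZ) (x : ℤ) :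
    Summable fun t : ℤ => ‖f t * ψ (x - t)‖ := by
  refine Summable.of_nonneg_of_le (fun _ => norm_nonneg _) (fun t => ?_)
    ((summable_norm_L1Z f).mul_right ‖ψ‖)
  rw [norm_mul]
  exact mul_le_mul_of_nonneg_left (lp.norm_apply_le_norm (by simp) ψ _) (norm_nonneg _)

theorem memℓp_conv (f : L1Z) (ψ : LInfZ) :
    Memℓp (fun x : ℤ => ∑' t : ℤ, f t * ψ (x - t)) ∞ := by
  refine memℓp_infty ⟨∑' t : ℤ, ‖f t‖ * ‖ψ‖, ?_⟩
  rintro _ ⟨x, rfl⟩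
  refine (norm_tsum_le_tsum_norm (summable_norm_conv f ψ x)).trans
    ((summable_norm_conv f ψ x).tsum_le_tsum (fun t => ?_)
      ((summable_norm_L1Z f).mul_right ‖ψ‖))
  rw [norm_mul]
  exact mul_le_mul_of_nonneg_left (lp.norm_apply_le_norm (by simp) ψ _) (norm_nonneg _)

/-- The convolution `(f * ψ)(x) = ∑_t f(t) ψ(x - t)`. -/
noncomputable def conv (f : L1Z) (ψ : LInfZ) : LInfZ :=
  ⟨fun x : ℤ => ∑' t : ℤ, f t * ψ (x - t), memℓp_conv f ψ⟩

/-- `P(ℤ)`: the nonnegative elements of `L¹(ℤ)` of total mass one. -/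
def ProbL1 : Set L1Z := {f | (∀ t, 0 ≤ f t) ∧ ∑' t : ℤ, f t = 1}

/-- A mean on `L^∞(ℤ)`: a continuous linear functional which is positive and normalized. -/
def IsMean (φ : StrongDual ℂ LInfZ) : Prop :=
  (∀ ψ : LInfZ, (∀ x, 0 ≤ ψ x) → 0 ≤ φ ψ) ∧ φ 1 = 1

/-- The set `𝒯` of topologically invariant means on `L^∞(ℤ)`. -/
def TopInvMeans : Set (StrongDual ℂ LInfZ) :=
  {φ | IsMean φ ∧ ∀ ψ : LInfZ, ∀ f ∈ ProbL1, φ (conv f ψ) = φ ψ}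

/-- `L^∞_{0,+}(ℤ)`: the bounded functions which tend to zero at `+∞`. -/
def LInfZeroPos : Set LInfZ := {ψ | Filter.Tendsto (fun x : ℤ => ψ x) Filter.atTop (𝓝 0)}

/-- The set `𝒯₊` of topologically invariant means vanishing on `L^∞_{0,+}(ℤ)`. -/
def TopInvMeansPos : Set (StrongDual ℂ LInfZ) :=
  {φ | φ ∈ TopInvMeans ∧ ∀ ψ ∈ LInfZeroPos, φ ψ = 0}

/-- One-sided almost convergence of a bounded function on `ℤ`. -/
def OneSidedAlmostConvergent (ψ : LInfZ) (α : ℂ) : Prop :=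
  ∀ φ ∈ TopInvMeansPos, φ ψ = α

theorem memℓp_extend (ψ : LInfN) :
    Memℓp (fun x : ℤ => if 0 ≤ x then ψ x.toNat else 0) ∞ := by
  refine memℓp_infty ⟨‖ψ‖, ?_⟩
  rintro _ ⟨x, rfl⟩
  dsimp only
  split_ifs
  · exact lp.norm_apply_le_norm (by simp) ψ _
  · simp

/-- The extension of a bounded sequence to `ℤ` by zero on the negative integers. -/
noncomputable def extendZero (ψ : LInfN) : LInfZ :=
  ⟨fun x : ℤ => if 0 ≤ x then ψ x.toNat else 0, memℓp_extend ψ⟩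

/-- One-sided almost convergence of a complex sequence: the sequence is bounded, and its
extension by zero to `ℤ` is one-sidedly almost convergent. -/
def SeqOneSidedAlmostConvergent (s : ℕ → ℂ) (α : ℂ) : Prop :=
  ∃ ψ : LInfN, (∀ n, ψ n = s n) ∧ OneSidedAlmostConvergent (extendZero ψ) α

/-- A complex sequence is bounded from below if its real and imaginary parts are. -/
def BoundedFromBelow (a : ℕ → ℂ) : Prop :=
  ∃ C : ℝ, 0 < C ∧ ∀ n, -C ≤ (a n).re ∧ -C ≤ (a n).im

end AlmostConv

namespace AlmostConv

open MeasureTheory Filter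
open scoped FourierTransform Convolution ContDiff

/-! This is a Tauberian argument with a positive kernel. Pick `k` on the circle, supported near `1`,
with nonnegative and rapidly decaying Fourier transform. Smoothing the coefficients of a power
series with `K.hat` gives the Fourier transform of `k` times the boundary values, so only the
behaviour near `1` matters (`LocalKernel.hasSum_abel`).

Applied to `f`, the smoothed Abel sums stay bounded as `r → 1`. Once the real and imaginary parts
are shifted by `C`, every term is nonnegative, so one term is bounded by the whole sum and `a` is
bounded (`LocalKernel.coeff_le`).

The numbers `s n - f 1` have generating function `(f z - f 1) / (1 - z)`, again analytic at `1`.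
They have bounded increments, so the first moment of the kernel allows `r → 1` and makes the
sequence bounded (`LocalKernel.norm_zeroExtend_le`). By Riemann–Lebesgue the smoothed sequence tends
to `0` at `+∞`. Smoothing is convolution with a probability, which an invariant mean does not see,
so every mean in question gives `s - f 1` the value `0`. -/

/-! ### The localizing kernel -/

/-- An integrable function on `ℝ` supported where `exp (2πit)` is within `ε` of `1`, whose Fourier
transform is nonnegative and has a finite first moment on `ℤ`. -/
structure LocalKernel (ε : ℝ) where
  /-- The function itself. -/
  toFun : ℝ → ℂ
  /-- Its Fourier transform. -/
  hat : ℝ → ℝ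
  integrable : Integrable toFun
  near_one : ∀ t, toFun t ≠ 0 → ‖((Real.fourierChar t : Circle) : ℂ) - 1‖ < ε
  fourier_eq : ∀ x, 𝓕 toFun x = (hat x : ℂ)
  hat_nonneg : ∀ x, 0 ≤ hat x
  hat_zero_pos : 0 < hat 0
  summable_hat : Summable fun n : ℤ => hat n
  summable_moment : Summable fun n : ℤ => |(n : ℝ)| * hat n

theorem fourier_im_eq_zero_of_even {ψ : ℝ → ℂ} (hreal : ∀ t, (starRingEnd ℂ) (ψ t) = ψ t)
    (heven : ∀ t, ψ (-t) = ψ t) (x : ℝ) : (𝓕 ψ x).im = 0 := by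
  rw [← Complex.conj_eq_iff_im, Real.fourier_real_eq, ← integral_conj,
    ← integral_neg_eq_self]
  congr 1 with t
  rw [Circle.smul_def, Circle.smul_def, smul_eq_mul, smul_eq_mul, map_mul, heven, hreal,
    ← Circle.coe_inv_eq_conj, ← AddChar.map_neg_eq_inv]
  congr 3
  ring

theorem summable_abs_mul_sq_schwartz (g : SchwartzMap ℝ ℂ) :
    Summable fun n : ℤ => |(n : ℝ)| * ‖g n‖ ^ 2 := by
  obtain ⟨C₁, -, h₁⟩ := g.decay 1 0
  obtain ⟨C₂, -, h₂⟩ := g.decay 2 0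
  simp only [norm_iteratedFDeriv_zero] at h₁ h₂
  refine Summable.of_nonneg_of_le (fun n => by positivity) (fun n => ?_)
    ((Real.summable_one_div_int_pow (p := 2).2 (by norm_num)).mul_left (C₁ * C₂))
  rcases eq_or_ne n 0 with rfl | hn
  · simp
  have hn' : (0 : ℝ) < |(n : ℝ)| := abs_pos.2 (Int.cast_ne_zero.2 hn)
  have h1 := h₁ n
  have h2 := h₂ n
  have h := mul_le_mul h1 h2 (by positivity) ((by positivity : (0:ℝ) ≤ _).trans h1)
  rw [mul_one_div, le_div_iff₀ (by positivity)]
  refine le_trans (le_of_eq ?_) h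
  rw [Real.norm_eq_abs, ← sq_abs (n : ℝ)]
  ring

/-- Convolve a small even real bump with itself: its transform is real, so that of the convolution
is a square. -/
theorem nonempty_localKernel {ε : ℝ} (hε : 0 < ε) : Nonempty (LocalKernel ε) := by
  have hc : ContinuousAt (fun t : ℝ => ((Real.fourierChar t : Circle) : ℂ)) 0 :=
    (continuous_subtype_val.comp Real.continuous_fourierChar).continuousAt
  obtain ⟨η, hη, hball⟩ := Metric.continuousAt_iff.1 hc ε hε
  let b : ContDiffBump (0 : ℝ) := ⟨η / 4, η / 2, by positivity, by linarith⟩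
  have hcs : HasCompactSupport fun t => (b t : ℂ) :=
    b.hasCompactSupport.comp_left (g := fun x : ℝ => (x : ℂ)) Complex.ofReal_zero
  let ψ : SchwartzMap ℝ ℂ := hcs.toSchwartzMap (Complex.ofRealCLM.contDiff.comp b.contDiff)
  have hψ : ∀ t, ψ t = (b t : ℂ) := fun t => rfl
  let K : SchwartzMap ℝ ℂ := SchwartzMap.convolution (ContinuousLinearMap.mul ℂ ℂ) ψ ψ
  have hK : (K : ℝ → ℂ) = (ψ : ℝ → ℂ) ⋆[ContinuousLinearMap.mul ℂ ℂ] (ψ : ℝ → ℂ) :=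
    funext fun t => SchwartzMap.convolution_apply _ _ _ _
  have him : ∀ x, (𝓕 (ψ : ℝ → ℂ) x).im = 0 := fourier_im_eq_zero_of_even
    (fun t => by simp [hψ]) (fun t => by simp [hψ, b.neg])
  have hF : ∀ x, ((𝓕 (ψ : ℝ → ℂ) x).re : ℂ) = 𝓕 (ψ : ℝ → ℂ) x := fun x =>
    Complex.ext (by simp) (by simp [him x])
  have hsq : ∀ x, ((𝓕 (ψ : ℝ → ℂ) x).re) ^ 2 = ‖(𝓕 ψ : SchwartzMap ℝ ℂ) x‖ ^ 2 := fun x => by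
    rw [SchwartzMap.fourier_coe, ← hF x, Complex.norm_real, Real.norm_eq_abs, sq_abs,
      Complex.ofReal_re]
  have hmom : Summable fun n : ℤ => |(n : ℝ)| * (𝓕 (ψ : ℝ → ℂ) n).re ^ 2 := by
    simp_rw [hsq]
    exact summable_abs_mul_sq_schwartz _
  refine ⟨⟨K, fun x => (𝓕 (ψ : ℝ → ℂ) x).re ^ 2, K.integrable, ?_, ?_, fun x => sq_nonneg _, ?_,
    ?_, hmom⟩⟩
  · intro t ht
    have ht' : t ∈ Function.support (K : ℝ → ℂ) := ht
    rw [hK] at ht'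
    obtain ⟨x, hx, y, hy, rfl⟩ := Set.mem_add.1 (support_convolution_subset _ ht')
    have hsupp : ∀ z, z ∈ Function.support (ψ : ℝ → ℂ) → |z| < η / 2 := fun z hz => by
      have : z ∈ Function.support b := fun h => hz (by simp [hψ, h])
      rw [b.support_eq] at this
      simpa using this
    have := hball (x := x + y) (by
      rw [dist_zero_right, Real.norm_eq_abs]
      linarith [abs_add_le x y, hsupp x hx, hsupp y hy])
    simpa [dist_eq_norm] using this
  · intro x
    rw [hK, Real.fourier_mul_convolution_eq ψ.integrable ψ.integrable, Complex.ofReal_pow, hF, sq]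
  · have h0 : 𝓕 (ψ : ℝ → ℂ) 0 = ((∫ t, b t : ℝ) : ℂ) := by
      rw [Real.fourier_real_eq, ← integral_complex_ofReal]
      simp [hψ]
    have := b.integral_pos (μ := volume)
    simp only [h0, Complex.ofReal_re]
    positivity
  -- Away from `0` the weight `|n|` is at least `1`, so the moment series dominates.
  · refine Summable.of_norm_bounded_eventually hmom ?_
    filter_upwards [(Set.finite_singleton (0 : ℤ)).compl_mem_cofinite] with n hn
    have h1 : (1 : ℝ) ≤ |(n : ℝ)| := by exact_mod_cast Int.one_le_abs hn
    rw [Real.norm_of_nonneg (sq_nonneg _)]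
    exact le_mul_of_one_le_left (sq_nonneg _) h1

/-! ### Smoothed Abel sums and boundary values -/

variable {ε : ℝ}

theorem norm_fourierChar_mul {r : ℝ} (hr : 0 ≤ r) (t : ℝ) :
    ‖(r : ℂ) * ((Real.fourierChar t : Circle) : ℂ)‖ = r := by
  rw [norm_mul, Circle.norm_coe, mul_one, Complex.norm_real, Real.norm_of_nonneg hr]

/-- Smoothing the Abel-weighted coefficients with `hat` amounts to localizing the boundary values
with the kernel. -/
theorem LocalKernel.hasSum_abel (K : LocalKernel ε) {c : ℕ → ℂ} {G : ℂ → ℂ}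
    (hG : ∀ z : ℂ, ‖z‖ < 1 → HasSum (fun n : ℕ => c n * z ^ n) (G z))
    {r : ℝ} (hr0 : 0 ≤ r) (hr1 : r < 1) (m : ℤ) :
    HasSum (fun n : ℕ => c n * (r : ℂ) ^ n * (K.hat ((m : ℝ) - n) : ℂ))
      (𝓕 (fun t : ℝ => K.toFun t * G (r * (Real.fourierChar t : Circle))) (m : ℝ)) := by
  have hs : Summable fun n : ℕ => ‖c n‖ * r ^ n := by
    have := (hG (r : ℂ) (by simpa [abs_of_nonneg hr0] using hr1)).summable.norm
    simpa [abs_of_nonneg hr0] using this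
  have key : ∀ n : ℕ, c n * (r : ℂ) ^ n * (K.hat ((m : ℝ) - n) : ℂ) =
      ∫ t : ℝ, c n * (r : ℂ) ^ n * (Real.fourierChar (-(t * ((m : ℝ) - n))) • K.toFun t) := by
    intro n
    rw [integral_const_mul, ← K.fourier_eq, Real.fourier_real_eq]
  simp_rw [key]
  rw [Real.fourier_real_eq]
  refine hasSum_integral_of_dominated_convergence (fun n t => ‖c n‖ * r ^ n * ‖K.toFun t‖)
    (fun n => ?_) (fun n => ?_) ?_ ?_ ?_
  · exact (((Real.fourierIntegral_convergent_iff (μ := volume) ((m : ℝ) - n)).2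
      K.integrable).aestronglyMeasurable.congr (by simp [mul_comm])).const_mul _
  · refine .of_forall fun t => ?_
    simp [abs_of_nonneg hr0]
  · exact .of_forall fun t => hs.mul_right _
  · simp_rw [tsum_mul_right]
    exact K.integrable.norm.const_mul _
  · refine .of_forall fun t => ?_
    have h := ((hG _ ((norm_fourierChar_mul hr0 t).trans_lt hr1)).mul_left
      (K.toFun t)).mul_left ((Real.fourierChar (-(t * (m : ℝ))) : Circle) : ℂ)
    rw [Circle.smul_def, smul_eq_mul]
    refine h.congr_fun ?_
    intro n
    have : Real.fourierChar (-(t * ((m : ℝ) - n))) =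
        Real.fourierChar (-(t * (m : ℝ))) * Real.fourierChar t ^ n := by
      rw [← AddChar.map_nsmul_eq_pow, ← AddChar.map_add_eq_mul]
      congr 1
      simp
      ring
    rw [Circle.smul_def, smul_eq_mul, this, mul_pow]
    push_cast
    ring

theorem mul_fourierChar_mem_ball {r : ℝ} (hr : 1 - ε ≤ r)
    (hr0 : 0 ≤ r) (hr1 : r ≤ 1) {t : ℝ} (ht : ‖((Real.fourierChar t : Circle) : ℂ) - 1‖ < ε) :
    (r : ℂ) * (Real.fourierChar t : Circle) ∈ Metric.ball (1 : ℂ) (2 * ε) := by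
  rw [Metric.mem_ball, dist_eq_norm]
  set e : ℂ := ((Real.fourierChar t : Circle) : ℂ)
  calc ‖(r : ℂ) * e - 1‖ = ‖(r : ℂ) * (e - 1) + ((r : ℂ) - 1)‖ := by congr 1; ring
    _ ≤ ‖(r : ℂ) * (e - 1)‖ + ‖(r : ℂ) - 1‖ := norm_add_le _ _
    _ = r * ‖e - 1‖ + (1 - r) := by
      rw [norm_mul, Complex.norm_real, Real.norm_of_nonneg hr0, ← Complex.ofReal_one,
        ← Complex.ofReal_sub, Complex.norm_real, Real.norm_of_nonpos (by linarith), neg_sub,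
        Complex.ofReal_one]
    _ < 2 * ε := by
      nlinarith [norm_nonneg (e - 1)]

theorem LocalKernel.norm_mul_le (K : LocalKernel ε) {G : ℂ → ℂ} {B r : ℝ}
    (hB : ∀ z ∈ Metric.ball (1 : ℂ) (2 * ε), ‖G z‖ ≤ B) (hr : 1 - ε ≤ r) (hr0 : 0 ≤ r)
    (hr1 : r ≤ 1) (t : ℝ) :
    ‖K.toFun t * G (r * (Real.fourierChar t : Circle))‖ ≤ B * ‖K.toFun t‖ := by
  by_cases ht : K.toFun t = 0
  · simp [ht]
  rw [norm_mul, mul_comm]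
  exact mul_le_mul_of_nonneg_right
    (hB _ (mul_fourierChar_mem_ball hr hr0 hr1 (K.near_one t ht))) (norm_nonneg _)

theorem LocalKernel.norm_fourier_le (K : LocalKernel ε) {G : ℂ → ℂ} {B r : ℝ}
    (hB : ∀ z ∈ Metric.ball (1 : ℂ) (2 * ε), ‖G z‖ ≤ B) (hr : 1 - ε ≤ r) (hr0 : 0 ≤ r)
    (hr1 : r ≤ 1) (x : ℝ) :
    ‖𝓕 (fun t : ℝ => K.toFun t * G (r * (Real.fourierChar t : Circle))) x‖ ≤
      B * ∫ t, ‖K.toFun t‖ := by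
  rw [Real.fourier_real_eq, ← integral_const_mul]
  refine norm_integral_le_of_norm_le (K.integrable.norm.const_mul B) (.of_forall fun t => ?_)
  rw [Circle.norm_smul]
  exact K.norm_mul_le hB hr hr0 hr1 t

theorem LocalKernel.aestronglyMeasurable_mul (K : LocalKernel ε) {G : ℂ → ℂ} {r : ℝ}
    (hG : ContinuousOn G (Metric.ball (1 : ℂ) (2 * ε))) (hr : 1 - ε ≤ r) (hr0 : 0 ≤ r)
    (hr1 : r ≤ 1) :
    AEStronglyMeasurable (fun t : ℝ => K.toFun t * G (r * (Real.fourierChar t : Circle))) := by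
  have he : Continuous fun t : ℝ => ((Real.fourierChar t : Circle) : ℂ) :=
    continuous_subtype_val.comp Real.continuous_fourierChar
  let U : Set ℝ := {t | ‖((Real.fourierChar t : Circle) : ℂ) - 1‖ < ε}
  have hU : MeasurableSet U :=
    (isOpen_lt (he.sub continuous_const).norm continuous_const).measurableSet
  -- `G` is controlled only on the ball, and off `U` the kernel vanishes, so an indicator can be
  -- inserted.
  have h : (fun t : ℝ => K.toFun t * G (r * (Real.fourierChar t : Circle))) =
      fun t => K.toFun t * U.indicator (fun t => G (r * (Real.fourierChar t : Circle))) t := by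
    funext t
    by_cases ht : K.toFun t = 0
    · simp [ht]
    · rw [Set.indicator_of_mem (show t ∈ U from K.near_one t ht)]
  rw [h]
  refine K.integrable.aestronglyMeasurable.mul ((aestronglyMeasurable_indicator_iff hU).2 ?_)
  refine ContinuousOn.aestronglyMeasurable ?_ hU
  exact hG.comp (continuous_const.mul he).continuousOn
    fun t ht => mul_fourierChar_mem_ball hr hr0 hr1 ht

/-- The boundary form of `LocalKernel.hasSum_abel`. -/
theorem LocalKernel.tsum_eq_fourier (K : LocalKernel ε) (hε : 0 < ε) {c : ℕ → ℂ} {G : ℂ → ℂ} {B : ℝ}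
    (hG : ∀ z : ℂ, ‖z‖ < 1 → HasSum (fun n : ℕ => c n * z ^ n) (G z))
    (hB : ∀ z ∈ Metric.ball (1 : ℂ) (2 * ε), ‖G z‖ ≤ B)
    (hGc : ContinuousOn G (Metric.ball (1 : ℂ) (2 * ε))) (m : ℤ)
    (hs : Summable fun n : ℕ => ‖c n‖ * K.hat ((m : ℝ) - n)) :
    ∑' n : ℕ, c n * (K.hat ((m : ℝ) - n) : ℂ) =
      𝓕 (fun t : ℝ => K.toFun t * G ((1 : ℝ) * (Real.fourierChar t : Circle))) (m : ℝ) := by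
  have hev : ∀ᶠ r : ℝ in 𝓝[<] 1, 1 - ε ≤ r ∧ 0 ≤ r ∧ r < 1 := by
    filter_upwards [self_mem_nhdsWithin,
      mem_nhdsWithin_of_mem_nhds (Ici_mem_nhds (show 1 - ε < 1 by linarith)),
      mem_nhdsWithin_of_mem_nhds (Ici_mem_nhds (zero_lt_one (α := ℝ)))] with r h1 h2 h3
    exact ⟨h2, h3, h1⟩
  have hid : Tendsto (fun r : ℝ => (r : ℂ)) (𝓝[<] 1) (𝓝 ((1 : ℝ) : ℂ)) :=
    (Complex.continuous_ofReal.tendsto 1).mono_left nhdsWithin_le_nhds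
  -- Both sides of the Abel identity pass to `r → 1` by dominated convergence: the series through
  -- `hs`, the integral through the bound `B` on the ball.
  have hsum : Tendsto (fun r : ℝ => ∑' n : ℕ, c n * (r : ℂ) ^ n * (K.hat ((m : ℝ) - n) : ℂ))
      (𝓝[<] 1) (𝓝 (∑' n : ℕ, c n * (K.hat ((m : ℝ) - n) : ℂ))) := by
    refine tendsto_tsum_of_dominated_convergence hs (fun n => ?_) ?_
    · simpa using (((hid.pow n).const_mul (c n)).mul_const (K.hat ((m : ℝ) - n) : ℂ))
    · filter_upwards [hev] with r hr n
      rw [norm_mul, norm_mul, norm_pow, Complex.norm_real, Complex.norm_real,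
        Real.norm_of_nonneg hr.2.1, Real.norm_of_nonneg (K.hat_nonneg _)]
      exact mul_le_mul_of_nonneg_right (mul_le_of_le_one_right (norm_nonneg _)
        (pow_le_one₀ hr.2.1 hr.2.2.le)) (K.hat_nonneg _)
  refine tendsto_nhds_unique hsum (Tendsto.congr' (f₁ := fun r : ℝ =>
    𝓕 (fun t : ℝ => K.toFun t * G (r * (Real.fourierChar t : Circle))) (m : ℝ)) ?_ ?_)
  · filter_upwards [hev] with r hr
    exact (K.hasSum_abel hG hr.2.1 hr.2.2 m).tsum_eq.symm
  simp_rw [Real.fourier_real_eq]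
  refine tendsto_integral_filter_of_dominated_convergence (fun t => B * ‖K.toFun t‖) ?_ ?_
    (K.integrable.norm.const_mul B) ?_
  · filter_upwards [hev] with r hr
    have he : Continuous fun t : ℝ => ((Real.fourierChar (-(t * (m : ℝ))) : Circle) : ℂ) :=
      continuous_subtype_val.comp (Real.continuous_fourierChar.comp (by fun_prop))
    exact he.aestronglyMeasurable.mul (K.aestronglyMeasurable_mul hGc hr.1 hr.2.1 hr.2.2.le)
  · filter_upwards [hev] with r hr
    refine .of_forall fun t => ?_
    rw [Circle.norm_smul]
    exact K.norm_mul_le hB hr.1 hr.2.1 hr.2.2.le t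
  · refine .of_forall fun t => Tendsto.const_smul ?_ _
    by_cases ht : K.toFun t = 0
    · simp [ht]
    refine Tendsto.const_mul _ (Tendsto.comp (hGc.continuousAt (Metric.isOpen_ball.mem_nhds
      (mul_fourierChar_mem_ball (by linarith) zero_le_one le_rfl (K.near_one t ht)))) ?_)
    exact hid.mul_const _

/-! ### Boundedness of the coefficients -/

theorem LocalKernel.summable_hat_sub (K : LocalKernel ε) (m : ℤ) :
    Summable fun x : ℤ => K.hat ((m : ℝ) - x) := by
  simpa [Function.comp_def] using (Equiv.subLeft m).summable_iff.2 K.summable_hat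

theorem LocalKernel.summable_moment_sub (K : LocalKernel ε) (m : ℤ) :
    Summable fun x : ℤ => |(m : ℝ) - x| * K.hat ((m : ℝ) - x) := by
  simpa [Function.comp_def] using (Equiv.subLeft m).summable_iff.2 K.summable_moment

theorem LocalKernel.tsum_hat_sub (K : LocalKernel ε) (m : ℤ) :
    ∑' x : ℤ, K.hat ((m : ℝ) - x) = ∑' x : ℤ, K.hat x := by
  simpa using (Equiv.subLeft m).tsum_eq fun x : ℤ => K.hat x

theorem LocalKernel.tsum_moment_sub (K : LocalKernel ε) (m : ℤ) :
    ∑' x : ℤ, |(m : ℝ) - x| * K.hat ((m : ℝ) - x) = ∑' x : ℤ, |(x : ℝ)| * K.hat x := by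
  simpa using (Equiv.subLeft m).tsum_eq fun x : ℤ => |(x : ℝ)| * K.hat x

theorem LocalKernel.tsum_hat_pos (K : LocalKernel ε) : 0 < ∑' x : ℤ, K.hat x :=
  K.summable_hat.tsum_pos (fun x => K.hat_nonneg x) 0 (by simpa using K.hat_zero_pos)

/-- A series bounded below whose Abel sums stay bounded near `1` has bounded coefficients: the
one-sided bound is used through the positivity of the kernel. -/
theorem LocalKernel.coeff_le (K : LocalKernel ε) (hε : 0 < ε) {a : ℕ → ℂ} {f : ℂ → ℂ} {B C : ℝ}
    (hC : 0 ≤ C) (hf : ∀ z : ℂ, ‖z‖ < 1 → HasSum (fun n : ℕ => a n * z ^ n) (f z))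
    (hB : ∀ z ∈ Metric.ball (1 : ℂ) (2 * ε), ‖f z‖ ≤ B) (L : ℂ →L[ℝ] ℝ) (hL : ∀ z, |L z| ≤ ‖z‖)
    (ha : ∀ n, -C ≤ L (a n)) (m : ℕ) :
    L (a m) * K.hat 0 ≤ B * (∫ t, ‖K.toFun t‖) + C * ∑' x : ℤ, K.hat x := by
  set R : ℝ := B * (∫ t, ‖K.toFun t‖) + C * ∑' x : ℤ, K.hat x
  have hinj : Function.Injective (Nat.cast : ℕ → ℤ) := Nat.cast_injective
  have hk : Summable fun n : ℕ => K.hat ((m : ℝ) - n) := by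
    simpa [Function.comp_def] using (K.summable_hat_sub m).comp_injective hinj
  have hkle : ∑' n : ℕ, K.hat ((m : ℝ) - n) ≤ ∑' x : ℤ, K.hat x := by
    rw [← K.tsum_hat_sub m]
    have := tsum_comp_le_tsum_of_inj (K.summable_hat_sub m) (fun x => K.hat_nonneg _) hinj
    simpa [Function.comp_def] using this
  have hmain : ∀ r : ℝ, 1 - ε ≤ r → 0 ≤ r → r < 1 → (L (a m) + C) * r ^ m * K.hat 0 ≤ R := by
    intro r h1 h0 hr
    have hsum := (K.hasSum_abel hf h0 hr m).mapL L
    have hLsum : ∀ n : ℕ, L (a n * (r : ℂ) ^ n * (K.hat (((m : ℕ) : ℤ) - n : ℝ) : ℂ)) =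
        L (a n) * r ^ n * K.hat ((m : ℝ) - n) := by
      intro n
      have : a n * (r : ℂ) ^ n * (K.hat (((m : ℕ) : ℤ) - n : ℝ) : ℂ) =
          (r ^ n * K.hat ((m : ℝ) - n)) • a n := by
        rw [Complex.real_smul]
        push_cast
        ring
      rw [this, map_smul, smul_eq_mul]
      ring
    simp only [hLsum] at hsum
    have hle : ∀ n : ℕ, C * r ^ n * K.hat ((m : ℝ) - n) ≤ C * K.hat ((m : ℝ) - n) := fun n =>
      mul_le_mul_of_nonneg_right (mul_le_of_le_one_right hC (pow_le_one₀ h0 hr.le))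
        (K.hat_nonneg _)
    have hsC : Summable fun n : ℕ => C * r ^ n * K.hat ((m : ℝ) - n) :=
      .of_nonneg_of_le (fun n => mul_nonneg (mul_nonneg hC (pow_nonneg h0 n)) (K.hat_nonneg _))
        hle (hk.mul_left C)
    -- Adding the series with constant coefficient `C` makes all terms nonnegative; only `n = m` is
    -- kept.
    have hterm := le_hasSum (hsum.add hsC.hasSum) m fun n _ => by
      rw [← add_mul, ← add_mul]
      exact mul_nonneg (mul_nonneg (by linarith [ha n]) (pow_nonneg h0 n)) (K.hat_nonneg _)
    rw [← add_mul, ← add_mul, sub_self] at hterm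
    refine hterm.trans (add_le_add ?_ ?_)
    · exact (le_abs_self _).trans ((hL _).trans (K.norm_fourier_le hB h1 h0 hr.le _))
    · refine (hsC.tsum_le_tsum hle (hk.mul_left C)).trans ?_
      rw [tsum_mul_left]
      exact mul_le_mul_of_nonneg_left hkle hC
  have hlim : Tendsto (fun r : ℝ => (L (a m) + C) * r ^ m * K.hat 0) (𝓝[<] 1)
      (𝓝 ((L (a m) + C) * 1 ^ m * K.hat 0)) :=
    Tendsto.mono_left (Continuous.tendsto (by fun_prop) 1) nhdsWithin_le_nhds
  have hfin : (L (a m) + C) * 1 ^ m * K.hat 0 ≤ R := by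
    refine le_of_tendsto hlim ?_
    filter_upwards [self_mem_nhdsWithin,
      mem_nhdsWithin_of_mem_nhds (Ici_mem_nhds (show 1 - ε < 1 by linarith)),
      mem_nhdsWithin_of_mem_nhds (Ici_mem_nhds (zero_lt_one (α := ℝ)))] with r h1 h2 h3
    exact hmain r h2 h3 h1
  rw [one_pow, mul_one, add_mul] at hfin
  exact (le_add_of_nonneg_right (mul_nonneg hC (K.hat_nonneg 0))).trans hfin

theorem exists_norm_coeff_le (K : LocalKernel ε) (hε : 0 < ε) {a : ℕ → ℂ} {f : ℂ → ℂ} {B : ℝ}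
    (ha : BoundedFromBelow a)
    (hf : ∀ z : ℂ, ‖z‖ < 1 → HasSum (fun n : ℕ => a n * z ^ n) (f z))
    (hB : ∀ z ∈ Metric.ball (1 : ℂ) (2 * ε), ‖f z‖ ≤ B) : ∃ A : ℝ, ∀ n, ‖a n‖ ≤ A := by
  obtain ⟨C, hC, ha⟩ := ha
  set R : ℝ := B * (∫ t, ‖K.toFun t‖) + C * ∑' x : ℤ, K.hat x
  have hre : ∀ n, (a n).re ≤ R / K.hat 0 := fun n => (le_div_iff₀ K.hat_zero_pos).2
    (K.coeff_le hε hC.le hf hB Complex.reCLM Complex.abs_re_le_norm (fun n => (ha n).1) n)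
  have him : ∀ n, (a n).im ≤ R / K.hat 0 := fun n => (le_div_iff₀ K.hat_zero_pos).2
    (K.coeff_le hε hC.le hf hB Complex.imCLM Complex.abs_im_le_norm (fun n => (ha n).2) n)
  refine ⟨max C (R / K.hat 0) + max C (R / K.hat 0), fun n => ?_⟩
  refine (Complex.norm_le_abs_re_add_abs_im _).trans (add_le_add ?_ ?_)
  · exact abs_le.2 ⟨by linarith [(ha n).1, le_max_left C (R / K.hat 0)],
      (hre n).trans (le_max_right _ _)⟩
  · exact abs_le.2 ⟨by linarith [(ha n).2, le_max_left C (R / K.hat 0)],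
      (him n).trans (le_max_right _ _)⟩

/-! ### Sequences with bounded increments -/

/-- The extension of a sequence to `ℤ` by zero on the negative integers. -/
noncomputable def zeroExtend (σ : ℕ → ℂ) (x : ℤ) : ℂ := if 0 ≤ x then σ x.toNat else 0

theorem zeroExtend_natCast (σ : ℕ → ℂ) (n : ℕ) : zeroExtend σ n = σ n := by simp [zeroExtend]

theorem zeroExtend_of_neg (σ : ℕ → ℂ) {x : ℤ} (hx : x < 0) : zeroExtend σ x = 0 := by
  simp [zeroExtend, not_le.2 hx]

theorem zeroExtend_eq_zero_of_notMem_range (σ : ℕ → ℂ) {x : ℤ}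
    (hx : x ∉ Set.range (Nat.cast : ℕ → ℤ)) : zeroExtend σ x = 0 :=
  zeroExtend_of_neg σ (not_le.1 fun h => hx ⟨x.toNat, Int.toNat_of_nonneg h⟩)

theorem norm_zeroExtend_sub_le {σ : ℕ → ℂ} {M : ℝ} (h0 : ‖σ 0‖ ≤ M)
    (hM : ∀ n, ‖σ (n + 1) - σ n‖ ≤ M) (x y : ℤ) :
    ‖zeroExtend σ x - zeroExtend σ y‖ ≤ M * |(x : ℝ) - y| := by
  have hM0 : 0 ≤ M := (norm_nonneg _).trans h0
  have hstep : ∀ x : ℤ, ‖zeroExtend σ (x + 1) - zeroExtend σ x‖ ≤ M := by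
    intro x
    rcases lt_trichotomy x (-1) with hx | rfl | hx
    · rw [zeroExtend_of_neg σ (by omega), zeroExtend_of_neg σ (by omega)]
      simpa using hM0
    -- The jump from `-1` to `0` is `σ 0` itself.
    · simpa [zeroExtend] using h0
    · lift x to ℕ using by omega
      rw [zeroExtend_natCast, ← Nat.cast_succ, zeroExtend_natCast]
      exact hM x
  have hn : ∀ (y : ℤ) (n : ℕ), ‖zeroExtend σ (y + n) - zeroExtend σ y‖ ≤ M * n := by
    intro y n
    induction n with
    | zero => simp
    | succ n ih =>
      have := norm_sub_le_norm_sub_add_norm_sub (zeroExtend σ (y + n + 1)) (zeroExtend σ (y + n))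
        (zeroExtend σ y)
      push_cast
      rw [← add_assoc]
      linarith [hstep (y + n)]
  wlog hxy : y ≤ x generalizing x y
  · rw [norm_sub_rev, abs_sub_comm]
    exact this y x (le_of_not_ge hxy)
  obtain ⟨n, rfl⟩ := Int.le.dest hxy
  simpa using hn y n

/-- Growth is at most linear in the distance to `m`, which the first moment absorbs. -/
theorem LocalKernel.summable_zeroExtend (K : LocalKernel ε) {σ : ℕ → ℂ} {M : ℝ}
    (hσ : ∀ x y : ℤ, ‖zeroExtend σ x - zeroExtend σ y‖ ≤ M * |(x : ℝ) - y|) (m : ℤ) :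
    Summable fun x : ℤ => ‖zeroExtend σ x‖ * K.hat ((m : ℝ) - x) := by
  refine Summable.of_nonneg_of_le (fun x => mul_nonneg (norm_nonneg _) (K.hat_nonneg _))
    (fun x => ?_) (((K.summable_hat_sub m).mul_left ‖zeroExtend σ m‖).add
      ((K.summable_moment_sub m).mul_left M))
  rw [← mul_assoc, ← add_mul]
  refine mul_le_mul_of_nonneg_right ?_ (K.hat_nonneg _)
  have := norm_sub_norm_le (zeroExtend σ x) (zeroExtend σ m)
  have h2 := hσ x m
  rw [abs_sub_comm] at h2
  linarith

theorem LocalKernel.tsum_zeroExtend (K : LocalKernel ε) (σ : ℕ → ℂ) (m : ℤ) :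
    ∑' x : ℤ, zeroExtend σ x * (K.hat ((m : ℝ) - x) : ℂ) =
      ∑' n : ℕ, σ n * (K.hat ((m : ℝ) - n) : ℂ) := by
  have hinj : Function.Injective (Nat.cast : ℕ → ℤ) := Nat.cast_injective
  rw [← hinj.tsum_eq]
  · simp [zeroExtend_natCast]
  · intro x hx
    by_contra h
    exact hx (by simp [zeroExtend_eq_zero_of_notMem_range σ h])

/-- A Lipschitz sequence whose smoothed values are bounded is bounded. -/
theorem LocalKernel.norm_zeroExtend_le (K : LocalKernel ε) {σ : ℕ → ℂ} {M R : ℝ}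
    (hσ : ∀ x y : ℤ, ‖zeroExtend σ x - zeroExtend σ y‖ ≤ M * |(x : ℝ) - y|) (m : ℤ)
    (hR : ‖∑' x : ℤ, zeroExtend σ x * (K.hat ((m : ℝ) - x) : ℂ)‖ ≤ R) :
    ‖zeroExtend σ m‖ * ∑' x : ℤ, K.hat x ≤ R + M * ∑' x : ℤ, |(x : ℝ)| * K.hat x := by
  have hn : ∀ z x, ‖z * (K.hat x : ℂ)‖ = ‖z‖ * K.hat x := fun z x => by
    rw [norm_mul, Complex.norm_real, Real.norm_of_nonneg (K.hat_nonneg x)]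
  have hs : Summable fun x : ℤ => zeroExtend σ x * (K.hat ((m : ℝ) - x) : ℂ) :=
    .of_norm (by simpa only [hn] using K.summable_zeroExtend hσ m)
  have hd : ∀ x : ℤ, ‖(zeroExtend σ m - zeroExtend σ x) * (K.hat ((m : ℝ) - x) : ℂ)‖ ≤
      M * (|(m : ℝ) - x| * K.hat ((m : ℝ) - x)) := fun x => by
    rw [hn, ← mul_assoc]
    exact mul_le_mul_of_nonneg_right (hσ m x) (K.hat_nonneg _)
  have hMs := (K.summable_moment_sub m).mul_left M
  have hds : Summable fun x : ℤ =>
      (zeroExtend σ m - zeroExtend σ x) * (K.hat ((m : ℝ) - x) : ℂ) := .of_norm_bounded hMs hd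
  -- The value at `m` times the kernel mass is the smoothed value plus an error controlled by the
  -- first moment.
  have hsplit : zeroExtend σ m * ((∑' x : ℤ, K.hat x : ℝ) : ℂ) =
      ∑' x : ℤ, zeroExtend σ x * (K.hat ((m : ℝ) - x) : ℂ) +
        ∑' x : ℤ, (zeroExtend σ m - zeroExtend σ x) * (K.hat ((m : ℝ) - x) : ℂ) := by
    rw [← hs.tsum_add hds, ← K.tsum_hat_sub m, Complex.ofReal_tsum, ← tsum_mul_left]
    congr 1 with x
    ring
  rw [← Real.norm_of_nonneg K.tsum_hat_pos.le, ← Complex.norm_real, ← norm_mul, hsplit,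
    ← K.tsum_moment_sub m, ← tsum_mul_left]
  exact (norm_add_le _ _).trans (add_le_add hR (tsum_of_norm_bounded hMs.hasSum hd))

/-! ### Partial sums near the point `1` -/

/-- The generating function of the partial sums. -/
theorem hasSum_partialSum_sub {a : ℕ → ℂ} {f : ℂ → ℂ}
    (hf : ∀ z : ℂ, ‖z‖ < 1 → HasSum (fun n : ℕ => a n * z ^ n) (f z)) {z : ℂ} (hz : ‖z‖ < 1) :
    HasSum (fun n : ℕ => ((∑ k ∈ Finset.range (n + 1), a k) - f 1) * z ^ n)
      (-dslope f 1 z) := by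
  have hz1 : z ≠ 1 := by
    rintro rfl
    simp at hz
  have hgeo := hasSum_geometric_of_norm_lt_one hz
  -- Partial sums arise from the Cauchy product with the geometric series.
  have h := hasSum_sum_range_mul_of_summable_norm (hf z hz).summable.norm hgeo.summable.norm
  rw [(hf z hz).tsum_eq, hgeo.tsum_eq] at h
  have h2 := h.sub (hgeo.mul_left (f 1))
  have hval : -dslope f 1 z = f z * (1 - z)⁻¹ - f 1 * (1 - z)⁻¹ := by
    rw [dslope_of_ne _ hz1, slope_def_field, ← sub_mul, ← neg_sub 1 z, div_neg, neg_neg,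
      div_eq_mul_inv]
  rw [hval]
  refine h2.congr_fun fun n => ?_
  rw [sub_mul, Finset.sum_mul]
  congr 1
  refine Finset.sum_congr rfl fun k hk => ?_
  rw [mul_assoc, ← pow_add, Nat.add_sub_cancel' (Nat.lt_succ_iff.1 (Finset.mem_range.1 hk))]

theorem exists_continuousOn_norm_le_of_analyticAt {g : ℂ → ℂ} {z : ℂ} (hg : AnalyticAt ℂ g z) :
    ∃ δ > 0, ∃ B, ContinuousOn g (Metric.ball z δ) ∧ ∀ w ∈ Metric.ball z δ, ‖g w‖ ≤ B := by
  have h1 := hg.eventually_analyticAt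
  have h2 : ∀ᶠ w in 𝓝 z, ‖g w‖ < ‖g z‖ + 1 :=
    hg.continuousAt.norm.eventually_lt_const (lt_add_one _)
  obtain ⟨δ, hδ, h⟩ := Metric.eventually_nhds_iff_ball.1 (h1.and h2)
  exact ⟨δ, hδ, _, fun w hw => (h w hw).1.continuousAt.continuousWithinAt,
    fun w hw => (h w hw).2.le⟩

/-! ### Invariant means and conclusion -/

theorem LocalKernel.memℓp_prob (K : LocalKernel ε) : Memℓp (E := fun _ : ℤ => ℂ)
    (fun t : ℤ => ((K.hat t / ∑' x : ℤ, K.hat x : ℝ) : ℂ)) 1 := by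
  rw [memℓp_gen_iff (by norm_num)]
  simpa using (K.summable_hat.div_const (∑' x : ℤ, K.hat x)).norm

/-- The kernel normalized to total mass one. -/
noncomputable def LocalKernel.prob (K : LocalKernel ε) : L1Z :=
  ⟨fun t : ℤ => ((K.hat t / ∑' x : ℤ, K.hat x : ℝ) : ℂ), K.memℓp_prob⟩

theorem LocalKernel.prob_apply (K : LocalKernel ε) (t : ℤ) :
    K.prob t = ((K.hat t / ∑' x : ℤ, K.hat x : ℝ) : ℂ) := rfl

theorem LocalKernel.prob_mem (K : LocalKernel ε) : K.prob ∈ ProbL1 := by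
  refine ⟨fun t => ?_, ?_⟩
  · rw [K.prob_apply, Complex.zero_le_real]
    exact div_nonneg (K.hat_nonneg _) K.tsum_hat_pos.le
  · simp_rw [K.prob_apply]
    rw [← Complex.ofReal_tsum, tsum_div_const, div_self K.tsum_hat_pos.ne', Complex.ofReal_one]

theorem LocalKernel.conv_prob_apply (K : LocalKernel ε) (ψ : LInfZ) (m : ℤ) :
    conv K.prob ψ m =
      (∑' x : ℤ, ψ x * (K.hat ((m : ℝ) - x) : ℂ)) * ((∑' x : ℤ, K.hat x : ℝ) : ℂ)⁻¹ := by
  change ∑' t : ℤ, K.prob t * ψ (m - t) = _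
  rw [← (Equiv.subLeft m).tsum_eq, ← tsum_mul_right]
  congr 1 with x
  simp only [Equiv.subLeft_apply, sub_sub_cancel, K.prob_apply]
  push_cast
  ring

/-- A bounded sequence whose difference from `α` has smoothed values tending to zero is
one-sidedly almost convergent to `α`. -/
theorem LocalKernel.seqOneSidedAlmostConvergent (K : LocalKernel ε) {s : ℕ → ℂ} {α : ℂ} {R : ℝ}
    (hR : ∀ x, ‖zeroExtend (fun n => s n - α) x‖ ≤ R)
    (h : Tendsto (fun m : ℤ => ∑' x : ℤ,
      zeroExtend (fun n => s n - α) x * (K.hat ((m : ℝ) - x) : ℂ)) atTop (𝓝 0)) :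
    SeqOneSidedAlmostConvergent s α := by
  have hs : Memℓp (E := fun _ : ℕ => ℂ) s ∞ := by
    refine memℓp_infty ⟨R + ‖α‖, ?_⟩
    rintro _ ⟨n, rfl⟩
    have h1 := hR n
    rw [zeroExtend_natCast] at h1
    linarith [norm_sub_norm_le (s n) α]
  have hτ : Memℓp (E := fun _ : ℤ => ℂ) (zeroExtend fun n => s n - α) ∞ :=
    memℓp_infty ⟨R, by rintro _ ⟨x, rfl⟩; exact hR x⟩
  let ψ : LInfN := ⟨s, hs⟩
  let τ : LInfZ := ⟨zeroExtend fun n => s n - α, hτ⟩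
  refine ⟨ψ, fun n => rfl, fun φ hφ => ?_⟩
  obtain ⟨⟨⟨-, hone⟩, hinv⟩, hzero⟩ := hφ
  have hφτ : φ τ = 0 := by
    rw [← hinv τ K.prob K.prob_mem]
    refine hzero _ ?_
    change Tendsto _ _ _
    simp_rw [K.conv_prob_apply]
    simpa using h.mul_const ((∑' x : ℤ, K.hat x : ℝ) : ℂ)⁻¹
  -- This function vanishes on `x ≥ 0`: extending `s - α` by zero differs from subtracting `α` only
  -- on negative integers.
  have hdiff : φ (extendZero ψ - τ - α • (1 : LInfZ)) = 0 := by
    refine hzero _ ?_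
    change Tendsto _ _ _
    refine tendsto_const_nhds.congr' ?_
    filter_upwards [eventually_ge_atTop 0] with x hx
    change 0 = (if 0 ≤ x then s x.toNat else 0) - zeroExtend (fun n => s n - α) x - α * 1
    simp [zeroExtend, hx]
  rw [map_sub, map_sub, map_smul, hφτ, hone, smul_eq_mul, mul_one, sub_zero, sub_eq_zero] at hdiff
  exact hdiff

theorem seqOneSidedAlmostConvergent_partialSum {a : ℕ → ℂ} (ha : BoundedFromBelow a) {f : ℂ → ℂ}
    (hf : ∀ z : ℂ, ‖z‖ < 1 → HasSum (fun n : ℕ => a n * z ^ n) (f z)) (hf1 : AnalyticAt ℂ f 1) :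
    SeqOneSidedAlmostConvergent (fun n : ℕ => ∑ k ∈ Finset.range (n + 1), a k) (f 1) := by
  obtain ⟨p, hp⟩ := hf1
  have hH : AnalyticAt ℂ (fun z => -dslope f 1 z) 1 :=
    (show AnalyticAt ℂ (dslope f 1) 1 from ⟨_, hp.has_fpower_series_dslope_fslope⟩).neg
  obtain ⟨δ₁, hδ₁, B₁, -, hB₁⟩ := exists_continuousOn_norm_le_of_analyticAt hp.analyticAt
  obtain ⟨δ₂, hδ₂, B₂, hc₂, hB₂⟩ := exists_continuousOn_norm_le_of_analyticAt hH
  let ε : ℝ := min δ₁ δ₂ / 2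
  have hε : 0 < ε := half_pos (lt_min hδ₁ hδ₂)
  have hε2 : 2 * ε = min δ₁ δ₂ := mul_div_cancel₀ _ two_ne_zero
  have hsub₁ : Metric.ball (1 : ℂ) (2 * ε) ⊆ Metric.ball 1 δ₁ :=
    Metric.ball_subset_ball (hε2.le.trans (min_le_left _ _))
  have hsub₂ : Metric.ball (1 : ℂ) (2 * ε) ⊆ Metric.ball 1 δ₂ :=
    Metric.ball_subset_ball (hε2.le.trans (min_le_right _ _))
  obtain ⟨K⟩ := nonempty_localKernel hε
  obtain ⟨A, hA⟩ := exists_norm_coeff_le K hε ha hf fun z hz => hB₁ z (hsub₁ hz)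
  set σ : ℕ → ℂ := fun n => (∑ k ∈ Finset.range (n + 1), a k) - f 1
  -- The summand `‖f 1‖` is needed only for the jump at `0`, where `σ 0 = a 0 - f 1`.
  have hLip : ∀ x y : ℤ, ‖zeroExtend σ x - zeroExtend σ y‖ ≤ (A + ‖f 1‖) * |(x : ℝ) - y| := by
    refine norm_zeroExtend_sub_le ?_ fun n => ?_
    · simpa [σ] using (norm_sub_le (a 0) (f 1)).trans (by linarith [hA 0])
    · simp only [σ, sub_sub_sub_cancel_right, Finset.sum_range_succ_sub_sum]
      linarith [hA (n + 1), norm_nonneg (f 1)]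
  have hσ : ∀ z : ℂ, ‖z‖ < 1 → HasSum (fun n : ℕ => σ n * z ^ n) (-dslope f 1 z) :=
    fun z hz => hasSum_partialSum_sub hf hz
  have hid : ∀ m : ℤ, ∑' x : ℤ, zeroExtend σ x * (K.hat ((m : ℝ) - x) : ℂ) =
      𝓕 (fun t : ℝ => K.toFun t * -dslope f 1 ((1 : ℝ) * (Real.fourierChar t : Circle)))
        (m : ℝ) := by
    intro m
    rw [K.tsum_zeroExtend]
    refine K.tsum_eq_fourier hε hσ (fun z hz => hB₂ z (hsub₂ hz)) (hc₂.mono hsub₂) m ?_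
    have := (K.summable_zeroExtend hLip m).comp_injective
      (Nat.cast_injective : Function.Injective (Nat.cast : ℕ → ℤ))
    simpa [Function.comp_def, zeroExtend_natCast] using this
  refine K.seqOneSidedAlmostConvergent
    (R := (B₂ * (∫ t, ‖K.toFun t‖) + (A + ‖f 1‖) * ∑' x : ℤ, |(x : ℝ)| * K.hat x) /
      ∑' x : ℤ, K.hat x) (fun x => ?_) ?_
  · rw [le_div_iff₀ K.tsum_hat_pos]
    refine K.norm_zeroExtend_le hLip x ?_
    rw [hid]
    exact K.norm_fourier_le (fun z hz => hB₂ z (hsub₂ hz)) (by linarith) zero_le_one le_rfl _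
  -- Riemann–Lebesgue lemma along the integers.
  · exact ((Real.zero_at_infty_fourier _).comp ((tendsto_intCast_atTop_atTop (R := ℝ)).mono_right
      atTop_le_cocompact)).congr fun m => (hid m).symm

end AlmostConv

/-- The function `f` is the sum of the power series on the open unit disc; analyticity at `1` is
that of `f` continued to a neighbourhood of `1`, so `f 1` is the value of this continuation. -/
theorem theorem8p3 (a : ℕ → ℂ) (ha : AlmostConv.BoundedFromBelow a)
    (f : ℂ → ℂ) (hf : ∀ z : ℂ, ‖z‖ < 1 → HasSum (fun n : ℕ => a n * z ^ n) (f z))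
    (hf1 : AnalyticAt ℂ f 1) :
    AlmostConv.SeqOneSidedAlmostConvergent
      (fun n : ℕ => ∑ k ∈ Finset.range (n + 1), a k) (f 1) :=
  AlmostConv.seqOneSidedAlmostConvergent_partialSum ha hf hf1
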